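/- Let $n\ge 2$. A radial space of dimension $n$ is $\mathbb{R}^n$ with the metric $\sigma=dr^2+g(r)^2\,d\theta^2$ in polar coordinates, where $g:[0,\infty)\to[0,\infty)$ is continuous and positive on $(0,\infty)$. Its radial profile $\varphi_\sigma$ assigns to $t=\mathrm{Vol}_\sigma(B(0,T))$, $0\le T<\infty$, the perimeter $\varphi_\sigma(t)=\mathcal H^{n-1}_\sigma(S(0,T))$, where $\mathcal H^{n-1}_\sigma$ is the Hausdorff measure of the Riemannian distance of $\sigma$. The space is nonsingular at $0$ if $g(r)/r\to1$ as $r\to0$, and it has a cone singularity of finite angle $\theta\in(0,\infty)$ at $0$ if $(g(r)/r)^{n-1}\to\theta$ as $r\to0$. Let $(X,d,\mu)$ be a metric measure space: a metric space in which closed bounded sets are compact, with a locally finite Borel measure $\mu$ that is positive on nonempty open sets. For Borel $A\subset X$ let $\mathrm{Per}(A)$ be the infimum of $\liminf_{i}\int_X \mathrm{lip}(f_i)\,d\mu$ over sequences of locally Lipschitz functions $f_i$ with $f_i\to\chi_A$ in $L^1(\mu)$, where $\mathrm{lip}(f)(x)=\limsup_{y\to x,\,y\neq x}|f(y)-f(x)|/d(y,x)$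 (and $0$ at isolated points). The isoperimetric profile of $X$ is $\Phi(t)=\inf\{\mathrm{Per}(A): A\subset X \text{ Borel},\ \mu(A)=t,\ \overline A\text{ compact}\}$, with $\inf\emptyset=+\infty$. One says that $X$ is dominated by $(\mathbb R^n,\sigma)$ if $\mathrm{Vol}_\sigma(\mathbb R^n)\ge\mu(X)/2$ and $\Phi(t)\ge\varphi_\sigma(t)$ for all $t\le\mu(X)/2$ that are the volume of a ball $B(0,T)$, $0\le T<\infty$. Suppose that $(X,d,\mu)$ is dominated by a radial space $(\mathbb R^n,\sigma)$ that is nonsingular at $0$ or has a cone singularity of finite angle $\theta\in(0,\infty)$ at $0$. Then, with $B_x(r)$ the open ball of centre $x$ and radius $r$, $$\inf_{x\in X}\mu(B_x(r))>0\quad\text{for every } r>0,$$ and $$\liminf_{r\to0}\ \inf_{x\in X}\frac{\mu(B_x(r))}{\omega_n r^n}>0,$$ where $\omega_n$ is the volume of the unit ball of $\mathbb R^n$ (infima and lower limit are taken in $[0,+\infty]$). -/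

import Mathlib

open MeasureTheory Filter Topology
open scoped ENNReal NNReal

noncomputable section

namespace RadialDomination

/-- The `n`-dimensional Euclidean vector space. -/
abbrev E (n : ℕ) : Type := EuclideanSpace ℝ (Fin n)

/-- The volume `ω_n` of the Euclidean unit ball of dimension `n`. -/
def unitBallVolume (n : ℕ) : ℝ≥0∞ := volume (Metric.ball (0 : E n) 1)

/-! ### Length, volume and Hausdorff measure of a (possibly singular) metric tensor on `E n` -/

section Tensor

variable {n : ℕ}

/-- The length of the curve `γ : [0, 1] → E n` for the metric tensor `σ`. -/
def curveLength (σ : E n → E n → E n → ℝ) (γ : ℝ → E n) : ℝ≥0∞ :=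
  ∫⁻ t in Set.Icc (0 : ℝ) 1, ENNReal.ofReal (Real.sqrt (σ (γ t) (deriv γ t) (deriv γ t)))

/-- The Riemannian distance of `σ`: the infimum of the lengths of `C¹` curves. -/
def riemannianDist (σ : E n → E n → E n → ℝ) (x y : E n) : ℝ≥0∞ :=
  ⨅ (γ : ℝ → E n) (_ : ContDiff ℝ 1 γ) (_ : γ 0 = x) (_ : γ 1 = y), curveLength σ γ

/-- The Riemannian volume of `σ`: Lebesgue measure with density `√(det (σ(eᵢ, eⱼ)))`. -/
def riemannianVolume (σ : E n → E n → E n → ℝ) : Measure (E n) :=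
  volume.withDensity fun x => ENNReal.ofReal <| Real.sqrt <| Matrix.det <|
    Matrix.of fun i j : Fin n =>
      σ x (EuclideanSpace.single i (1 : ℝ)) (EuclideanSpace.single j (1 : ℝ))

/-- The diameter of a set for a distance function `d`. -/
def diamOf {Y : Type*} (d : Y → Y → ℝ≥0∞) (U : Set Y) : ℝ≥0∞ :=
  ⨆ (x ∈ U) (y ∈ U), d x y

/-- The `k`-dimensional Hausdorff (outer) measure of a set for a distance function `d`, with the
normalisation (volume of the unit ball of dimension `k`, divided by `2 ^ k`) for which it agrees
with the Lebesgue measure in Euclidean space of dimension `k`. -/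
def hausdorffMeasureOf {Y : Type*} (d : Y → Y → ℝ≥0∞) (k : ℕ) (A : Set Y) : ℝ≥0∞ :=
  unitBallVolume k / 2 ^ k *
    ⨆ (δ : ℝ≥0∞) (_ : 0 < δ),
      ⨅ (U : ℕ → Set Y) (_ : A ⊆ ⋃ i, U i) (_ : ∀ i, diamOf d (U i) ≤ δ),
        ∑' i, ⨆ _ : (U i).Nonempty, diamOf d (U i) ^ k

end Tensor

/-! ### Radial spaces -/

/-- A radial space of dimension `n`: the vector space `E n` with the metric
`dr² + g(r)² dθ²` in polar coordinates. The function `g` is continuous on `[0, ∞)` and positive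
away from `0`. -/
structure RadialSpace (n : ℕ) where
  /-- The warping function. -/
  g : ℝ → ℝ
  continuousOn_g : ContinuousOn g (Set.Ici 0)
  g_pos : ∀ r : ℝ, 0 < r → 0 < g r

namespace RadialSpace

variable {n : ℕ} (S : RadialSpace n)

/-- The metric tensor `dr² + g(r)² dθ²`. At a point `x ≠ 0`, with `r = ‖x‖`, one has
`dr(v) = ⟪x, v⟫ / r`, and `dθ²` is `r⁻²` times the Euclidean inner product of the components
orthogonal to `x`. Polar coordinates say nothing at the origin, where the tensor is given the
Euclidean value; this single point affects neither lengths nor volumes. -/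
def metric (x v w : E n) : ℝ :=
  if x = 0 then inner ℝ v w
  else
    inner ℝ x v / ‖x‖ * (inner ℝ x w / ‖x‖) +
      (S.g ‖x‖ / ‖x‖) ^ 2 * (inner ℝ v w - inner ℝ x v / ‖x‖ * (inner ℝ x w / ‖x‖))

/-- The Riemannian volume of a radial space. -/
def vol : Measure (E n) := riemannianVolume S.metric

/-- The perimeter of the centred ball of radius `T`: the `(n-1)`-dimensional Hausdorff measure,
for the Riemannian distance of the radial space, of the centred sphere `{r = T}`. (For the metric
`dr² + g(r)² dθ²`, the distance to the origin is `r = ‖x‖`.) -/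
def sphereArea (T : ℝ≥0) : ℝ≥0∞ :=
  hausdorffMeasureOf (riemannianDist S.metric) (n - 1) (Metric.sphere (0 : E n) T)

/-- The radial profile: `radialProfile t` is the perimeter of the centred ball of volume `t`.
There is at most one radius `T` for which the centred ball has volume `t`, so the supremum is over
at most one value; if there is none (`t` is not the volume of a centred ball of finite radius), the
value is `0`. -/
def radialProfile (t : ℝ≥0∞) : ℝ≥0∞ :=
  ⨆ (T : ℝ≥0) (_ : S.vol (Metric.ball (0 : E n) T) = t), S.sphereArea T

/-- The radial space is nonsingular at zero. -/
def IsNonsingular : Prop :=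
  Tendsto (fun r => S.g r / r) (𝓝[>] 0) (𝓝 1)

/-- The radial space has at zero a cone singularity of total angle `θ`, where `0 < θ < ∞`
(normalised so that `θ = 1` is the nonsingular case). -/
def HasConeAngle (θ : ℝ) : Prop :=
  0 < θ ∧ Tendsto (fun r => (S.g r / r) ^ (n - 1)) (𝓝[>] 0) (𝓝 θ)

end RadialSpace

/-! ### Perimeter and isoperimetric profile of a metric measure space -/

section MetricMeasure

variable {X : Type*} [MetricSpace X]

/-- The pointwise Lipschitz constant `lip f (x) = limsup_{y → x, y ≠ x} |f y - f x| / d(y, x)`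
(which is `0` at an isolated point). -/
def lip (f : X → ℝ) (x : X) : ℝ≥0∞ :=
  limsup (fun y => edist (f y) (f x) / edist y x) (𝓝[≠] x)

variable [MeasurableSpace X]

/-- The perimeter of `A`, that is the total variation of its indicator function: the smallest
`liminf ∫ lip (fᵢ) dμ` over locally Lipschitz functions `fᵢ` that tend to `χ_A` in `L¹(μ)`. -/
def perimeter (μ : Measure X) (A : Set X) : ℝ≥0∞ :=
  ⨅ (f : ℕ → X → ℝ) (_ : ∀ i, LocallyLipschitz (f i))
    (_ : Tendsto (fun i => ∫⁻ x, ‖f i x - A.indicator 1 x‖ₑ ∂μ) atTop (𝓝 0)),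
    liminf (fun i => ∫⁻ x, lip (f i) x ∂μ) atTop

/-- The isoperimetric profile `Φ(t)`: the infimum of the perimeters of the Borel sets of measure
`t` with compact closure. -/
def isoperimetricProfile (μ : Measure X) (t : ℝ≥0∞) : ℝ≥0∞ :=
  ⨅ (A : Set X) (_ : MeasurableSet A) (_ : μ A = t) (_ : IsCompact (closure A)), perimeter μ A

/-- The metric measure space `(X, d, μ)` is dominated by the radial space `S`. -/
def IsDominatedBy (μ : Measure X) {n : ℕ} (S : RadialSpace n) : Prop :=
  μ Set.univ / 2 ≤ S.vol Set.univ ∧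
    ∀ t : ℝ≥0∞, t ≤ μ Set.univ / 2 → S.radialProfile t ≤ isoperimetricProfile μ t

end MetricMeasure

end RadialDomination

end

namespace RadialDomination

/-! ### Perimeter of metric balls -/

section Perimeter

variable {X : Type*} [MetricSpace X]

/-! An isoperimetric inequality is integrated over concentric balls. Fix `x` and put `V s = μ (ball
x s)`. This function is monotone, and at each point of differentiability the perimeter of the ball
is at most `V' s`, as radial cut-offs show (`perimeter_ball_le`). As long as `V s ≤ μ X / 2`,
domination turns this into `V' s ≥ φ (V s)`, where `φ` is the radial profile.

Write `n = k + 1`. Near the origin `g r / r` lies between two positive constants. Hence a centred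
ball of radius `T` has volume at most a multiple of `T ^ n`, and its sphere has area at least a
multiple of `T ^ k`. So `φ t` is at least a multiple of `t ^ (k / n)` for small `t`
(`exists_le_radialProfile`). The constants are not sharp, since only positivity of the lower limit
is claimed.

Therefore `V ^ (1 / n)` has derivative at least some `m > 0` almost everywhere, and `V r ≥ (m r) ^
n` (`pow_le_of_isoperimetric`). This holds while `V` stays below a fixed threshold; beyond the
threshold the bound is immediate for small `r`. Neither `m` nor the threshold depends on `x`, which
gives both conclusions. -/

theorem lip_le_of_lipschitzWith {f : X → ℝ} {K : ℝ≥0} (hf : LipschitzWith K f) (x : X) :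
    lip f x ≤ K := by
  refine Filter.limsup_le_of_le (by isBoundedDefault) (Eventually.of_forall fun y => ?_)
  exact ENNReal.div_le_of_le_mul (hf y x)

theorem lip_eq_zero_of_eventuallyEq {f : X → ℝ} {x : X} (hf : ∀ᶠ y in 𝓝 x, f y = f x) :
    lip f x = 0 := by
  refine le_antisymm (Filter.limsup_le_of_le (by isBoundedDefault) ?_) zero_le
  filter_upwards [hf.filter_mono nhdsWithin_le_nhds] with y hy
  simp [hy]

/-- The cut-off function that is `1` on the ball of radius `s - h` about `x`, vanishes outside the
ball of radius `s`, and is linear in the distance in between. -/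
noncomputable def ramp (x : X) (s h : ℝ) (y : X) : ℝ := max 0 (min 1 ((s - dist y x) / h))

theorem lipschitzWith_ramp (x : X) (s : ℝ) {h : ℝ} (hh : 0 < h) :
    LipschitzWith (Real.toNNReal (1 / h)) (ramp x s h) := by
  have : LipschitzWith (Real.toNNReal (1 / h)) fun y => (s - dist y x) / h := by
    refine LipschitzWith.of_dist_le_mul fun y z => ?_
    rw [Real.coe_toNNReal _ (by positivity), Real.dist_eq, ← sub_div, abs_div, abs_of_pos hh,
      div_mul_eq_mul_div, one_mul]
    gcongr
    have := abs_dist_sub_le z y x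
    rwa [dist_comm z y, ← sub_sub_sub_cancel_left _ _ s] at this
  exact (this.const_min 1).const_max 0

theorem ramp_eq_one {x y : X} {s h : ℝ} (hh : 0 < h) (hy : dist y x ≤ s - h) :
    ramp x s h y = 1 := by
  have : 1 ≤ (s - dist y x) / h := by rw [le_div_iff₀ hh]; linarith
  simp [ramp, this]

theorem ramp_eq_zero {x y : X} {s h : ℝ} (hh : 0 < h) (hy : s ≤ dist y x) :
    ramp x s h y = 0 := by
  have : (s - dist y x) / h ≤ 0 := div_nonpos_of_nonpos_of_nonneg (by linarith) hh.le
  exact max_eq_left ((min_le_right _ _).trans this)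

theorem ramp_nonneg (x : X) (s h : ℝ) (y : X) : 0 ≤ ramp x s h y := le_max_left _ _

theorem ramp_le_one (x : X) (s h : ℝ) (y : X) : ramp x s h y ≤ 1 :=
  max_le zero_le_one (min_le_left _ _)

/-- The cut-off is locally constant on the two open sets that make up the complement of this closed
annulus. -/
theorem lip_ramp_le (x : X) (s : ℝ) {h : ℝ} (hh : 0 < h) (y : X) :
    lip (ramp x s h) y ≤
      (Metric.closedBall x s \ Metric.ball x (s - h)).indicator
        (fun _ => ENNReal.ofReal (1 / h)) y := by
  by_cases hy : y ∈ Metric.closedBall x s \ Metric.ball x (s - h)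
  · rw [Set.indicator_of_mem hy]
    exact lip_le_of_lipschitzWith (lipschitzWith_ramp x s hh) y
  · rw [Set.indicator_of_notMem hy]
    refine (lip_eq_zero_of_eventuallyEq ?_).le
    simp only [Set.mem_sdiff, Metric.mem_closedBall, Metric.mem_ball, not_and_or, not_le,
      not_not] at hy
    rcases hy with hy | hy
    · have : ∀ᶠ z in 𝓝 y, s < dist z x :=
        (continuous_id.dist continuous_const).continuousAt.eventually (lt_mem_nhds hy)
      filter_upwards [this] with z hz
      rw [ramp_eq_zero hh hz.le, ramp_eq_zero hh hy.le]
    · have : ∀ᶠ z in 𝓝 y, dist z x < s - h :=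
        (continuous_id.dist continuous_const).continuousAt.eventually (gt_mem_nhds hy)
      filter_upwards [this] with z hz
      rw [ramp_eq_one hh hz.le, ramp_eq_one hh hy.le]

theorem enorm_ramp_sub_indicator_le (x : X) (s : ℝ) {h : ℝ} (hh : 0 < h) (y : X) :
    ‖ramp x s h y - (Metric.ball x s).indicator 1 y‖ₑ ≤
      (Metric.closedBall x s \ Metric.ball x (s - h)).indicator (fun _ => 1) y := by
  by_cases hy : y ∈ Metric.closedBall x s \ Metric.ball x (s - h)
  · rw [Set.indicator_of_mem hy, ← ofReal_norm, ENNReal.ofReal_le_one, Real.norm_eq_abs]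
    have h0 := ramp_nonneg x s h y
    have h1 := ramp_le_one x s h y
    by_cases hb : y ∈ Metric.ball x s
    · rw [Set.indicator_of_mem hb, Pi.one_apply, abs_le]; constructor <;> linarith
    · rw [Set.indicator_of_notMem hb, abs_le]; constructor <;> linarith
  · rw [Set.indicator_of_notMem hy]
    simp only [Set.mem_sdiff, Metric.mem_closedBall, Metric.mem_ball, not_and_or, not_le,
      not_not] at hy
    rcases hy with hy | hy
    · rw [ramp_eq_zero hh hy.le, Set.indicator_of_notMem (by simpa using hy.le)]; simp
    · rw [ramp_eq_one hh hy.le,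
        Set.indicator_of_mem (show y ∈ Metric.ball x s by rw [Metric.mem_ball]; linarith)]
      simp

variable [ProperSpace X] [MeasurableSpace X] [BorelSpace X]

/-- Continuity of the volume at `s` makes the sphere of radius `s` null, so closed and open balls
have equal measure. -/
theorem measure_annulus_eq (μ : Measure X) [IsLocallyFiniteMeasure μ] {x : X} {s : ℝ}
    (hs : ContinuousAt (fun r => μ.real (Metric.ball x r)) s) {h : ℝ} (hh : 0 < h) :
    μ (Metric.closedBall x s \ Metric.ball x (s - h)) =
      ENNReal.ofReal (μ.real (Metric.ball x s) - μ.real (Metric.ball x (s - h))) := by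
  have hle : μ.real (Metric.closedBall x s) ≤ μ.real (Metric.ball x s) := by
    refine ge_of_tendsto (hs.tendsto.mono_left (nhdsWithin_le_nhds (s := Set.Ioi s))) ?_
    filter_upwards [self_mem_nhdsWithin] with r hr
    exact measureReal_mono (Metric.closedBall_subset_ball hr) measure_ball_lt_top.ne
  have heq : μ.real (Metric.closedBall x s) = μ.real (Metric.ball x s) :=
    le_antisymm hle (measureReal_mono Metric.ball_subset_closedBall
      (isCompact_closedBall x s).measure_lt_top.ne)
  have hsub : Metric.ball x (s - h) ⊆ Metric.closedBall x s :=
    (Metric.ball_subset_ball (by linarith)).trans Metric.ball_subset_closedBall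
  rw [← heq, ← measureReal_sdiff hsub measurableSet_ball
    (isCompact_closedBall x s).measure_lt_top.ne, measureReal_def, ENNReal.ofReal_toReal]
  exact (measure_mono Set.sdiff_subset |>.trans_lt (isCompact_closedBall x s).measure_lt_top).ne

/-- The perimeter of a ball is at most the derivative of the volume with respect to the radius. -/
theorem perimeter_ball_le (μ : Measure X) [IsLocallyFiniteMeasure μ] {x : X} {s D : ℝ}
    (hs : HasDerivAt (fun r => μ.real (Metric.ball x r)) D s) :
    perimeter μ (Metric.ball x s) ≤ ENNReal.ofReal D := by
  let h : ℕ → ℝ := fun i => 1 / ((i : ℝ) + 1)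
  have hh : ∀ i, 0 < h i := fun i => Nat.one_div_pos_of_nat
  have h0 : Tendsto h atTop (𝓝 0) := tendsto_one_div_add_atTop_nhds_zero_nat
  have hsh : Tendsto (fun i => s - h i) atTop (𝓝 s) := by
    simpa using (tendsto_const_nhds (x := s)).sub h0
  have hsh' : Tendsto (fun i => s - h i) atTop (𝓝[≠] s) :=
    tendsto_nhdsWithin_iff.2 ⟨hsh, Eventually.of_forall fun i => by
      simpa using (hh i).ne'⟩
  have hmeas : ∀ i, MeasurableSet (Metric.closedBall x s \ Metric.ball x (s - h i)) :=
    fun i => measurableSet_closedBall.diff measurableSet_ball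
  refine iInf₂_le_of_le (fun i => ramp x s (h i))
    (fun i => (lipschitzWith_ramp x s (hh i)).locallyLipschitz) (iInf_le_of_le ?_ ?_)
  · have hlim : Tendsto (fun i => ENNReal.ofReal
        (μ.real (Metric.ball x s) - μ.real (Metric.ball x (s - h i)))) atTop (𝓝 0) := by
      have := (hs.continuousAt.tendsto.comp hsh).const_sub (μ.real (Metric.ball x s))
      simpa using ENNReal.tendsto_ofReal this
    refine tendsto_of_tendsto_of_tendsto_of_le_of_le tendsto_const_nhds hlim
      (fun _ => zero_le) fun i => ?_
    calc _ ≤ ∫⁻ y, (Metric.closedBall x s \ Metric.ball x (s - h i)).indicator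
          (fun _ => (1 : ℝ≥0∞)) y ∂μ :=
          lintegral_mono fun y => enorm_ramp_sub_indicator_le x s (hh i) y
      _ = _ := by
        rw [lintegral_indicator_const (hmeas i), one_mul,
          measure_annulus_eq μ hs.continuousAt (hh i)]
  -- The integral of `lip` is at most `1 / h` times the measure of the annulus, a difference
  -- quotient of the volume at `s`.
  · have hlim : Tendsto (fun i => ENNReal.ofReal
        (slope (fun r => μ.real (Metric.ball x r)) s (s - h i))) atTop (𝓝 (ENNReal.ofReal D)) :=
      ENNReal.tendsto_ofReal (hs.tendsto_slope.comp hsh')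
    rw [← hlim.liminf_eq]
    refine liminf_le_liminf (Eventually.of_forall fun i => ?_)
    calc _ ≤ ∫⁻ y, (Metric.closedBall x s \ Metric.ball x (s - h i)).indicator
          (fun _ => ENNReal.ofReal (1 / h i)) y ∂μ :=
          lintegral_mono fun y => lip_ramp_le x s (hh i) y
      _ = _ := by
        rw [lintegral_indicator_const (hmeas i), measure_annulus_eq μ hs.continuousAt (hh i),
          ← ENNReal.ofReal_mul (by have := hh i; positivity), slope_def_field]
        congr 1
        rw [← neg_sub (μ.real (Metric.ball x s)), sub_sub_cancel_left, neg_div_neg_eq, one_div,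
          inv_mul_eq_div]

end Perimeter

end RadialDomination

namespace RadialDomination

/-! ### Riemannian distance against Euclidean distance -/

section Tensor

variable {n : ℕ} (S : RadialSpace n)

/-- Split `v` into radial and tangential components: the metric leaves the first unchanged, whence
`a ≤ 1`, and scales the second by `g r / r ≥ a`. -/
theorem RadialSpace.mul_norm_sq_le_metric {a : ℝ} (ha0 : 0 ≤ a) (ha1 : a ≤ 1) (x v : E n)
    (hx : x ≠ 0 → a ≤ S.g ‖x‖ / ‖x‖) : (a * ‖v‖) ^ 2 ≤ S.metric x v v := by
  have ha2 : a ^ 2 ≤ 1 := pow_le_one₀ ha0 ha1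
  rw [mul_pow]
  unfold RadialSpace.metric
  split_ifs with h
  · rw [real_inner_self_eq_norm_sq]
    exact mul_le_of_le_one_left (by positivity) ha2
  · have hx0 : 0 < ‖x‖ := norm_pos_iff.2 h
    have hq : a ^ 2 ≤ (S.g ‖x‖ / ‖x‖) ^ 2 := pow_le_pow_left₀ ha0 (hx h) 2
    have hp : |inner ℝ x v / ‖x‖| ≤ ‖v‖ := by
      rw [abs_div, abs_norm, div_le_iff₀ hx0, mul_comm]
      exact abs_real_inner_le_norm x v
    have hp2 : (inner ℝ x v / ‖x‖) * (inner ℝ x v / ‖x‖) ≤ ‖v‖ ^ 2 := by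
      rw [← sq, ← sq_abs]
      exact pow_le_pow_left₀ (abs_nonneg _) hp 2
    rw [real_inner_self_eq_norm_sq]
    have h1 := mul_le_mul_of_nonneg_right hq (sub_nonneg.2 hp2)
    have h2 := mul_le_mul_of_nonneg_right ha2 (mul_self_nonneg (inner ℝ x v / ‖x‖))
    linarith

/-- The curve is followed up to time `1`, or up to the first time it reaches radius `R`. In the
second case it has already moved a Euclidean distance `R - T ≥ 2 T`, at least that between its
endpoints; hence `3 T ≤ R`. -/
theorem RadialSpace.mul_edist_le_curveLength {a R T : ℝ} (ha0 : 0 ≤ a) (ha1 : a ≤ 1)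
    (hg : ∀ r, 0 < r → r ≤ R → a ≤ S.g r / r) (hT : 3 * T ≤ R) {γ : ℝ → E n}
    (hγ : ContDiff ℝ 1 γ) (h0 : ‖γ 0‖ ≤ T) (h1 : ‖γ 1‖ ≤ T) :
    ENNReal.ofReal a * edist (γ 0) (γ 1) ≤ curveLength S.metric γ := by
  have hexit : ∃ t ∈ Set.Icc (0 : ℝ) 1, (∀ u ∈ Set.Ico 0 t, ‖γ u‖ ≤ R) ∧
      edist (γ 0) (γ 1) ≤ edist (γ t) (γ 0) := by
    by_cases hin : ∀ u ∈ Set.Icc (0 : ℝ) 1, ‖γ u‖ < R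
    · exact ⟨1, by simp, fun u hu => (hin u ⟨hu.1, hu.2.le⟩).le, (edist_comm _ _).le⟩
    · push Not at hin
      obtain ⟨u, hu, huR⟩ := hin
      have hcl : IsCompact (Set.Icc (0 : ℝ) 1 ∩ {t | R ≤ ‖γ t‖}) :=
        isCompact_Icc.inter_right (isClosed_le continuous_const hγ.continuous.norm)
      obtain ⟨t, ⟨ht, htR⟩, htmin⟩ := hcl.exists_isLeast ⟨u, hu, huR⟩
      refine ⟨t, ht, fun w hw => ?_, ?_⟩
      · by_contra! hlt
        exact absurd (htmin ⟨⟨hw.1, hw.2.le.trans ht.2⟩, hlt.le⟩) (not_le.2 hw.2)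
      · rw [edist_dist, edist_dist]
        refine ENNReal.ofReal_le_ofReal ?_
        rw [dist_eq_norm, dist_eq_norm]
        have e1 := norm_sub_le (γ 0) (γ 1)
        have e2 := norm_sub_norm_le (γ t) (γ 0)
        have e3 : R ≤ ‖γ t‖ := htR
        linarith
  obtain ⟨t, ht, hin, hd⟩ := hexit
  calc ENNReal.ofReal a * edist (γ 0) (γ 1)
      ≤ ENNReal.ofReal a * ∫⁻ u in Set.Icc 0 t, ‖deriv γ u‖ₑ := by
        gcongr
        refine hd.trans ?_
        rw [edist_eq_enorm_sub]
        exact enorm_sub_le_lintegral_deriv_of_contDiffOn_Icc hγ.contDiffOn ht.1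
    _ = ∫⁻ u in Set.Ico 0 t, ENNReal.ofReal (a * ‖deriv γ u‖) := by
        rw [← lintegral_const_mul' _ _ ENNReal.ofReal_ne_top,
          ← setLIntegral_congr Ico_ae_eq_Icc]
        simp_rw [ENNReal.ofReal_mul ha0, ofReal_norm]
    _ ≤ ∫⁻ u in Set.Ico 0 t,
          ENNReal.ofReal (Real.sqrt (S.metric (γ u) (deriv γ u) (deriv γ u))) := by
        refine setLIntegral_mono' measurableSet_Ico fun u hu => ENNReal.ofReal_le_ofReal ?_
        exact Real.le_sqrt_of_sq_le (S.mul_norm_sq_le_metric ha0 ha1 _ _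
          fun h => hg _ (norm_pos_iff.2 h) (hin u hu))
    _ ≤ curveLength S.metric γ :=
        lintegral_mono_set (Set.Ico_subset_Icc_self.trans (Set.Icc_subset_Icc_right ht.2))

theorem RadialSpace.mul_edist_le_riemannianDist {a R T : ℝ} (ha0 : 0 ≤ a) (ha1 : a ≤ 1)
    (hg : ∀ r, 0 < r → r ≤ R → a ≤ S.g r / r) (hT : 3 * T ≤ R) {x y : E n}
    (hx : ‖x‖ ≤ T) (hy : ‖y‖ ≤ T) :
    ENNReal.ofReal a * edist x y ≤ riemannianDist S.metric x y := by
  refine le_iInf fun γ => le_iInf fun hγ => le_iInf fun h0 => le_iInf fun h1 => ?_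
  subst h0 h1
  exact S.mul_edist_le_curveLength ha0 ha1 hg hT hγ hx hy

end Tensor

/-! ### Hausdorff measure of spheres, by projection to a ball -/

section Hausdorff

variable {k : ℕ}

/-- The projection that forgets the last coordinate. -/
def dropLast (x : E (k + 1)) : E k := WithLp.toLp 2 fun i => x i.castSucc

theorem lipschitzWith_dropLast : LipschitzWith 1 (dropLast (k := k)) := by
  refine LipschitzWith.of_dist_le_mul fun x y => ?_
  rw [NNReal.coe_one, one_mul, EuclideanSpace.dist_eq, EuclideanSpace.dist_eq]
  refine Real.sqrt_le_sqrt ?_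
  rw [Fin.sum_univ_castSucc]
  exact le_add_of_nonneg_right (sq_nonneg _)

theorem closedBall_subset_dropLast_image_sphere (T : ℝ) :
    Metric.closedBall (0 : E k) T ⊆ dropLast '' Metric.sphere (0 : E (k + 1)) T := by
  intro y hy
  rw [mem_closedBall_zero_iff] at hy
  have hT : 0 ≤ T := (norm_nonneg y).trans hy
  refine ⟨WithLp.toLp 2 (Fin.snoc (α := fun _ => ℝ) (fun i => y i)
    (Real.sqrt (T ^ 2 - ‖y‖ ^ 2))), ?_, ?_⟩
  · rw [mem_sphere_zero_iff_norm, ← sq_eq_sq₀ (norm_nonneg _) hT, EuclideanSpace.real_norm_sq_eq,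
      Fin.sum_univ_castSucc]
    simp only [Fin.snoc_castSucc, Fin.snoc_last]
    rw [Real.sq_sqrt (sub_nonneg.2 (pow_le_pow_left₀ (norm_nonneg _) hy 2)),
      EuclideanSpace.real_norm_sq_eq]
    ring
  · ext i
    simp [dropLast]

theorem unitBallVolume_pos : 0 < unitBallVolume k := Metric.measure_ball_pos _ _ one_pos

theorem unitBallVolume_ne_top : unitBallVolume k ≠ ∞ := measure_ball_lt_top.ne

theorem volume_closedBall_eq (x : E k) {r : ℝ} (hr : 0 ≤ r) :
    volume (Metric.closedBall x r) = ENNReal.ofReal r ^ k * unitBallVolume k := by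
  rw [Measure.addHaar_closedBall _ _ hr, finrank_euclideanSpace_fin, ENNReal.ofReal_pow hr]
  rfl

/-- A set of diameter at most `D` in `E k` has volume at most that of a ball of radius `D`. -/
theorem volume_le_of_edist_le (hk : k ≠ 0) {A : Set (E k)} {D : ℝ≥0∞}
    (hA : ∀ x ∈ A, ∀ y ∈ A, edist x y ≤ D) : volume A ≤ D ^ k * unitBallVolume k := by
  rcases A.eq_empty_or_nonempty with rfl | ⟨p, hp⟩
  · simp
  rcases eq_or_ne D ∞ with rfl | hD
  · simp [hk, ENNReal.top_mul unitBallVolume_pos.ne']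
  rw [← ENNReal.ofReal_toReal hD, ← volume_closedBall_eq p ENNReal.toReal_nonneg]
  refine measure_mono fun y hy => ?_
  rw [Metric.mem_closedBall, dist_edist]
  exact ENNReal.toReal_mono hD (hA y hy p hp)

/-- The pieces of a cover of the sphere project to a cover of the `k`-dimensional ball of radius
`T`. A piece of `d`-diameter `D` has a shadow of Euclidean diameter at most `D / a`. Bounding the
shadow by a ball of that radius avoids the isodiametric inequality. -/
theorem le_hausdorffMeasureOf_sphere (hk : k ≠ 0) {d : E (k + 1) → E (k + 1) → ℝ≥0∞} {a : ℝ≥0∞}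
    {T : ℝ} (hT : 0 ≤ T)
    (hd : ∀ x ∈ Metric.sphere (0 : E (k + 1)) T, ∀ y ∈ Metric.sphere (0 : E (k + 1)) T,
      a * edist x y ≤ d x y) :
    unitBallVolume k / 2 ^ k * (a * ENNReal.ofReal T) ^ k ≤
      hausdorffMeasureOf d k (Metric.sphere 0 T) := by
  unfold hausdorffMeasureOf
  gcongr
  -- Any scale `δ` serves, since the estimate holds for covers by sets of any size.
  refine le_iSup₂_of_le 1 one_pos (le_iInf fun U => le_iInf fun hU => le_iInf fun _ => ?_)
  set A := Metric.sphere (0 : E (k + 1)) T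
  have hpiece : ∀ i, a ^ k * volume (dropLast '' (U i ∩ A)) ≤
      (⨆ _ : (U i).Nonempty, diamOf d (U i) ^ k) * unitBallVolume k := by
    intro i
    rcases (U i ∩ A).eq_empty_or_nonempty with h | h
    · simp [h]
    rw [ciSup_pos h.left]
    rcases eq_or_ne a 0 with rfl | ha0
    · simp [hk]
    rcases eq_or_ne (diamOf d (U i)) ∞ with hD | hD
    · simp [hD, hk, ENNReal.top_mul unitBallVolume_pos.ne']
    -- For `a = ∞`, a piece of finite diameter has at most one point in its shadow.
    rcases eq_or_ne a ∞ with rfl | ha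
    · have : volume (dropLast '' (U i ∩ A)) ≤ 0 ^ k * unitBallVolume k := by
        refine volume_le_of_edist_le hk ?_
        rintro _ ⟨x, hx, rfl⟩ _ ⟨y, hy, rfl⟩
        by_contra! h0
        have hxy : edist x y ≠ 0 := fun h => by
          have := lipschitzWith_dropLast x y
          rw [h] at this
          simp_all
        have h1 : d x y ≤ diamOf d (U i) :=
          le_iSup₂_of_le x hx.1 (le_iSup₂_of_le y hy.1 le_rfl)
        have h2 := hd x hx.2 y hy.2
        rw [ENNReal.top_mul hxy] at h2
        exact hD (top_le_iff.1 (h2.trans h1))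
      simp_all
    have : volume (dropLast '' (U i ∩ A)) ≤ (diamOf d (U i) / a) ^ k * unitBallVolume k := by
      refine volume_le_of_edist_le hk ?_
      rintro _ ⟨x, hx, rfl⟩ _ ⟨y, hy, rfl⟩
      have h1 : d x y ≤ diamOf d (U i) :=
        le_iSup₂_of_le x hx.1 (le_iSup₂_of_le y hy.1 le_rfl)
      have h2 := lipschitzWith_dropLast x y
      rw [ENNReal.coe_one, one_mul] at h2
      rw [ENNReal.le_div_iff_mul_le (Or.inl ha0) (Or.inl ha), mul_comm]
      exact (mul_le_mul_right h2 a).trans ((hd x hx.2 y hy.2).trans h1)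
    calc _ ≤ a ^ k * ((diamOf d (U i) / a) ^ k * unitBallVolume k) := by gcongr
      _ = _ := by rw [← mul_assoc, ← mul_pow, ENNReal.mul_div_cancel ha0 ha]
  have hcover : Metric.closedBall (0 : E k) T ⊆ ⋃ i, dropLast '' (U i ∩ A) := by
    rw [← Set.image_iUnion, ← Set.iUnion_inter, Set.inter_eq_right.2 hU]
    exact closedBall_subset_dropLast_image_sphere T
  rw [← ENNReal.mul_le_mul_iff_left unitBallVolume_pos.ne' unitBallVolume_ne_top]
  calc _ = a ^ k * volume (Metric.closedBall (0 : E k) T) := by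
        rw [volume_closedBall_eq _ hT, mul_pow, mul_assoc]
    _ ≤ a ^ k * ∑' i, volume (dropLast '' (U i ∩ A)) := by
        gcongr
        exact (measure_mono hcover).trans (measure_iUnion_le _)
    _ ≤ _ := by
        rw [← ENNReal.tsum_mul_left, ← ENNReal.tsum_mul_right]
        exact ENNReal.tsum_le_tsum hpiece

end Hausdorff

end RadialDomination

namespace RadialDomination

/-! ### Volume and profile of a radial space near the origin -/

namespace RadialSpace

variable {k : ℕ} (S : RadialSpace (k + 1))

/-- With `u = x / ‖x‖`, the Gram matrix is `s (1 + ((1 - s) / s) u uᵀ)`, a rank-one perturbation of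
the identity up to scale. The determinant is `s ^ (k + 1) * (1 + (1 - s) / s) = s ^ k`. -/
theorem det_metric {x : E (k + 1)} (hx : x ≠ 0) :
    (Matrix.of fun i j : Fin (k + 1) => S.metric x (EuclideanSpace.single i (1 : ℝ))
      (EuclideanSpace.single j (1 : ℝ))).det = ((S.g ‖x‖ / ‖x‖) ^ k) ^ 2 := by
  have hx0 : 0 < ‖x‖ := norm_pos_iff.2 hx
  have hq : S.g ‖x‖ / ‖x‖ ≠ 0 := (div_pos (S.g_pos _ hx0) hx0).ne'
  set s := (S.g ‖x‖ / ‖x‖) ^ 2 with hs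
  have hs0 : s ≠ 0 := pow_ne_zero _ hq
  have hsum : ∑ i, x i / ‖x‖ * (x i / ‖x‖) = 1 := by
    have h1 : ∑ i, x i * x i = ‖x‖ ^ 2 := by
      rw [EuclideanSpace.real_norm_sq_eq]; exact Finset.sum_congr rfl fun i _ => (sq _).symm
    calc _ = ∑ i, x i * x i / ‖x‖ ^ 2 := Finset.sum_congr rfl fun i _ => by ring
      _ = 1 := by rw [← Finset.sum_div, h1, div_self (by positivity)]
  have hmat : (Matrix.of fun i j : Fin (k + 1) => S.metric x (EuclideanSpace.single i (1 : ℝ))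
      (EuclideanSpace.single j (1 : ℝ))) =
      s • (1 + Matrix.replicateCol Unit (fun i => (1 - s) / s * (x i / ‖x‖)) *
        Matrix.replicateRow Unit fun i => x i / ‖x‖) := by
    ext i j
    have hij : inner ℝ (EuclideanSpace.single i (1 : ℝ)) (EuclideanSpace.single j (1 : ℝ)) =
        (1 : Matrix (Fin (k + 1)) (Fin (k + 1)) ℝ) i j := by
      simp [EuclideanSpace.inner_single_left, Matrix.one_apply]
    rw [Matrix.of_apply, metric, if_neg hx, hij, ← hs]
    simp only [EuclideanSpace.inner_single_right,
      Matrix.smul_apply, Matrix.add_apply, Matrix.mul_apply, Matrix.replicateCol_apply,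
      Matrix.replicateRow_apply, Finset.univ_unique, Finset.sum_const, Finset.card_singleton,
      one_smul, smul_eq_mul, one_mul, conj_trivial]
    field_simp
    ring
  have hdot : (fun i => x i / ‖x‖) ⬝ᵥ (fun i => (1 - s) / s * (x i / ‖x‖)) = (1 - s) / s := by
    simp only [dotProduct]
    calc _ = ∑ i, (1 - s) / s * (x i / ‖x‖ * (x i / ‖x‖)) :=
          Finset.sum_congr rfl fun i _ => by ring
      _ = _ := by rw [← Finset.mul_sum, hsum, mul_one]
  rw [hmat, Matrix.det_smul, Matrix.det_one_add_replicateCol_mul_replicateRow, hdot,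
    Fintype.card_fin, pow_succ, mul_assoc]
  have : s * (1 + (1 - s) / s) = 1 := by field_simp; ring
  rw [this, mul_one, hs, ← pow_mul, ← pow_mul, mul_comm]

theorem sqrt_det_metric {x : E (k + 1)} (hx : x ≠ 0) :
    Real.sqrt (Matrix.of fun i j : Fin (k + 1) => S.metric x (EuclideanSpace.single i (1 : ℝ))
      (EuclideanSpace.single j (1 : ℝ))).det = (S.g ‖x‖ / ‖x‖) ^ k := by
  have hx0 : 0 < ‖x‖ := norm_pos_iff.2 hx
  rw [S.det_metric hx, Real.sqrt_sq (pow_nonneg (div_pos (S.g_pos _ hx0) hx0).le k)]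

theorem vol_apply {A : Set (E (k + 1))} (hA : MeasurableSet A) :
    S.vol A = ∫⁻ x in A, ENNReal.ofReal ((S.g ‖x‖ / ‖x‖) ^ k) := by
  rw [vol, riemannianVolume, withDensity_apply _ hA]
  refine lintegral_congr_ae (ae_restrict_of_ae ?_)
  have : ∀ᵐ x : E (k + 1), x ≠ 0 := by simp [ae_iff]
  filter_upwards [this] with x hx
  rw [S.sqrt_det_metric hx]

variable {a b R : ℝ}

theorem vol_le (hb : ∀ r, 0 < r → r ≤ R → S.g r / r ≤ b)
    {A : Set (E (k + 1))} (hA : MeasurableSet A) (hAR : ∀ x ∈ A, ‖x‖ ≤ R) :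
    S.vol A ≤ ENNReal.ofReal (b ^ k) * volume A := by
  rw [S.vol_apply hA, ← setLIntegral_const]
  refine lintegral_mono_ae ((ae_restrict_iff' hA).2 ?_)
  have : ∀ᵐ x : E (k + 1), x ≠ 0 := by simp [ae_iff]
  filter_upwards [this] with x hx hxA
  have hx0 : 0 < ‖x‖ := norm_pos_iff.2 hx
  have := (div_pos (S.g_pos _ hx0) hx0).le
  have := hb _ hx0 (hAR x hxA)
  gcongr

theorem le_vol (ha : ∀ r, 0 < r → r ≤ R → a ≤ S.g r / r) (ha0 : 0 ≤ a)
    {A : Set (E (k + 1))} (hA : MeasurableSet A) (hAR : ∀ x ∈ A, ‖x‖ ≤ R) :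
    ENNReal.ofReal (a ^ k) * volume A ≤ S.vol A := by
  rw [S.vol_apply hA, ← setLIntegral_const]
  refine lintegral_mono_ae ((ae_restrict_iff' hA).2 ?_)
  have : ∀ᵐ x : E (k + 1), x ≠ 0 := by simp [ae_iff]
  filter_upwards [this] with x hx hxA
  have := ha _ (norm_pos_iff.2 hx) (hAR x hxA)
  gcongr

theorem volume_real_ball {T : ℝ} (hT : 0 ≤ T) :
    volume.real (Metric.ball (0 : E (k + 1)) T) =
      T ^ (k + 1) * (unitBallVolume (k + 1)).toReal := by
  rw [measureReal_def, Measure.addHaar_ball _ _ hT, finrank_euclideanSpace_fin,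
    ENNReal.toReal_mul, ENNReal.toReal_ofReal (by positivity)]
  rfl

theorem vol_real_le (hb : ∀ r, 0 < r → r ≤ R → S.g r / r ≤ b) (hb0 : 1 ≤ b)
    {A : Set (E (k + 1))} (hA : MeasurableSet A) (hAR : A ⊆ Metric.ball 0 R) :
    S.vol.real A ≤ b ^ k * volume.real A := by
  have hfin : volume A ≠ ∞ := (measure_mono hAR |>.trans_lt measure_ball_lt_top).ne
  have := ENNReal.toReal_mono (ENNReal.mul_ne_top ENNReal.ofReal_ne_top hfin)
    (S.vol_le hb hA fun x hx => (mem_ball_zero_iff.1 (hAR hx)).le)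
  rwa [ENNReal.toReal_mul, ENNReal.toReal_ofReal (by positivity)] at this

theorem vol_ball_ne_top (hb : ∀ r, 0 < r → r ≤ R → S.g r / r ≤ b)
    {T : ℝ} (hT : T ≤ R) : S.vol (Metric.ball 0 T) ≠ ∞ := by
  refine ((S.vol_le hb measurableSet_ball fun x hx =>
    (mem_ball_zero_iff.1 hx).le.trans hT).trans_lt ?_).ne
  exact ENNReal.mul_lt_top ENNReal.ofReal_lt_top measure_ball_lt_top

theorem continuousOn_vol_ball (hb : ∀ r, 0 < r → r ≤ R → S.g r / r ≤ b) (hb0 : 1 ≤ b) :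
    ContinuousOn (fun T => S.vol.real (Metric.ball 0 T)) (Set.Icc 0 R) := by
  -- Increments of the Riemannian volume are dominated by those of `W`, a multiple of the Euclidean
  -- volume.
  let W : ℝ → ℝ := fun T => b ^ k * (T ^ (k + 1) * (unitBallVolume (k + 1)).toReal)
  have hW : Continuous W := by fun_prop
  have key : ∀ T ∈ Set.Icc 0 R, ∀ T' ∈ Set.Icc 0 R, T ≤ T' →
      dist (S.vol.real (Metric.ball 0 T')) (S.vol.real (Metric.ball 0 T)) ≤
        dist (W T') (W T) := by
    intro T hT T' hT' hTT
    have hsub : Metric.ball (0 : E (k + 1)) T ⊆ Metric.ball 0 T' := Metric.ball_subset_ball hTT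
    have h1 := S.vol_real_le hb hb0 (measurableSet_ball.diff measurableSet_ball)
      (Set.sdiff_subset.trans (Metric.ball_subset_ball hT'.2) :
        Metric.ball (0 : E (k + 1)) T' \ Metric.ball 0 T ⊆ Metric.ball 0 R)
    rw [measureReal_sdiff hsub measurableSet_ball (S.vol_ball_ne_top hb hT'.2),
      measureReal_sdiff hsub measurableSet_ball measure_ball_lt_top.ne, volume_real_ball hT.1,
      volume_real_ball hT'.1, mul_sub] at h1
    have h2 := measureReal_mono hsub (S.vol_ball_ne_top hb hT'.2)
    rw [Real.dist_eq, abs_of_nonneg (sub_nonneg.2 h2)]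
    exact h1.trans (le_abs_self _)
  have key' : ∀ T ∈ Set.Icc 0 R, ∀ T' ∈ Set.Icc 0 R,
      dist (S.vol.real (Metric.ball 0 T')) (S.vol.real (Metric.ball 0 T)) ≤
        dist (W T') (W T) := by
    intro T hT T' hT'
    rcases le_total T T' with h | h
    · exact key T hT T' hT' h
    · rw [dist_comm, dist_comm (W T')]
      exact key T' hT' T hT h
  intro T hT
  have hlim : Tendsto (fun T' => dist (W T') (W T)) (𝓝[Set.Icc 0 R] T) (𝓝 0) :=
    (tendsto_iff_dist_tendsto_zero.1 hW.continuousAt).mono_left nhdsWithin_le_nhds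
  refine tendsto_iff_dist_tendsto_zero.2 (squeeze_zero' (Eventually.of_forall fun _ =>
    dist_nonneg) ?_ hlim)
  filter_upwards [self_mem_nhdsWithin] with T' hT' using key' T hT T' hT'

theorem le_sphereArea (hk : k ≠ 0) (ha : ∀ r, 0 < r → r ≤ R → a ≤ S.g r / r) (ha0 : 0 ≤ a)
    (ha1 : a ≤ 1) {T : ℝ≥0} (hT : 3 * (T : ℝ) ≤ R) :
    ENNReal.ofReal ((unitBallVolume k).toReal / 2 ^ k * a ^ k * T ^ k) ≤ S.sphereArea T := by
  refine le_trans (le_of_eq ?_) (le_hausdorffMeasureOf_sphere hk (a := ENNReal.ofReal a) T.2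
    fun x hx y hy => S.mul_edist_le_riemannianDist ha0 ha1 ha hT (mem_sphere_zero_iff_norm.1 hx).le
      (mem_sphere_zero_iff_norm.1 hy).le)
  rw [mul_assoc, ← mul_pow, ENNReal.ofReal_mul (by positivity), ENNReal.ofReal_pow (by positivity),
    ENNReal.ofReal_mul ha0, ENNReal.ofReal_div_of_pos (by positivity),
    ENNReal.ofReal_toReal unitBallVolume_ne_top, ENNReal.ofReal_pow (by norm_num)]
  simp

/-- Near zero, the radial profile is at least that of a cone, up to a constant: every small volume
`t` is that of a ball whose radius `T` satisfies `t ≤ (K T) ^ (k + 1)`, and the profile at `t` is at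
least `c T ^ k`. -/
theorem exists_le_radialProfile (hk : k ≠ 0) (ha : ∀ r, 0 < r → r ≤ R → a ≤ S.g r / r)
    (ha0 : 0 < a) (ha1 : a ≤ 1) (hb : ∀ r, 0 < r → r ≤ R → S.g r / r ≤ b) (hb1 : 1 ≤ b)
    (hR : 0 < R) :
    ∃ c > 0, ∃ K > 0, ∃ t₀ > 0, ∀ t : ℝ, 0 ≤ t → t ≤ t₀ →
      ∃ T : ℝ, 0 ≤ T ∧ t ≤ (K * T) ^ (k + 1) ∧
        ENNReal.ofReal (c * T ^ k) ≤ S.radialProfile (ENNReal.ofReal t) := by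
  have hω : 0 < (unitBallVolume k).toReal :=
    ENNReal.toReal_pos unitBallVolume_pos.ne' unitBallVolume_ne_top
  set ω := (unitBallVolume (k + 1)).toReal
  have hR3 : R / 3 ≤ R := by linarith
  have ht₀ : 0 < S.vol.real (Metric.ball 0 (R / 3)) := by
    refine ENNReal.toReal_pos (ne_of_gt ?_) (S.vol_ball_ne_top hb hR3)
    refine lt_of_lt_of_le ?_ (S.le_vol ha ha0.le measurableSet_ball fun x hx =>
      (mem_ball_zero_iff.1 hx).le.trans hR3)
    exact ENNReal.mul_pos (ENNReal.ofReal_pos.2 (by positivity)).ne'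
      (Metric.measure_ball_pos _ _ (by positivity)).ne'
  -- The maximum with `1` ensures that `K ≤ K ^ (k + 1)`, which avoids taking a root.
  refine ⟨(unitBallVolume k).toReal / 2 ^ k * a ^ k, by positivity, max 1 (b ^ k * ω),
    by positivity, _, ht₀, fun t ht0 ht => ?_⟩
  -- The profile is `0` by default at values that are not volumes of centred balls, so a radius must
  -- be exhibited. It is kept below `R / 3` for `le_sphereArea`.
  have hivt := intermediate_value_Icc (by positivity : (0 : ℝ) ≤ R / 3)
    ((S.continuousOn_vol_ball hb hb1).mono (Set.Icc_subset_Icc_right hR3))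
  simp only [Metric.ball_zero, measureReal_empty] at hivt
  obtain ⟨T, ⟨hT0, hT3⟩, hTt⟩ := hivt ⟨ht0, ht⟩
  replace hTt : S.vol.real (Metric.ball 0 T) = t := hTt
  have hTR : T ≤ R := hT3.trans hR3
  refine ⟨T, hT0, ?_, ?_⟩
  · have h1 := S.vol_real_le hb hb1 measurableSet_ball (Metric.ball_subset_ball hTR)
    rw [volume_real_ball hT0] at h1
    calc t = S.vol.real (Metric.ball 0 T) := hTt.symm
      _ ≤ b ^ k * ω * T ^ (k + 1) := h1.trans (le_of_eq (by ring))
      _ ≤ max 1 (b ^ k * ω) ^ (k + 1) * T ^ (k + 1) := by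
        gcongr
        exact (le_max_right _ _).trans (le_self_pow₀ (le_max_left _ _) k.succ_ne_zero)
      _ = _ := (mul_pow _ _ _).symm
  · lift T to ℝ≥0 using hT0
    have hvol : S.vol (Metric.ball 0 T) = ENNReal.ofReal t := by
      rw [← hTt, measureReal_def, ENNReal.ofReal_toReal (S.vol_ball_ne_top hb hTR)]
    exact le_iSup₂_of_le T hvol (S.le_sphereArea hk ha ha0.le ha1 (by linarith))

theorem HasConeAngle.exists_bounds {S : RadialSpace (k + 1)} {θ : ℝ} (hk : k ≠ 0)
    (h : S.HasConeAngle θ) :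
    ∃ a b R : ℝ, 0 < a ∧ a ≤ 1 ∧ 1 ≤ b ∧ 0 < R ∧
      (∀ r, 0 < r → r ≤ R → a ≤ S.g r / r) ∧ (∀ r, 0 < r → r ≤ R → S.g r / r ≤ b) := by
  obtain ⟨hθ, hlim⟩ := h
  rw [Nat.add_sub_cancel] at hlim
  have hev := hlim.eventually (Ioo_mem_nhds (by linarith : θ / 2 < θ) (by linarith : θ < 2 * θ))
  obtain ⟨R, hR, hsub⟩ := mem_nhdsGT_iff_exists_Ioc_subset.1 hev
  -- Roots are avoided: `q ^ k ≤ q` for `0 ≤ q ≤ 1` and `q ≤ q ^ k` for `q ≥ 1`.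
  refine ⟨min 1 (θ / 2), max 1 (2 * θ), R, by positivity, min_le_left _ _, le_max_left _ _, hR,
    fun r hr hrR => ?_, fun r hr hrR => ?_⟩
  · have h1 : θ / 2 < (S.g r / r) ^ k := (hsub ⟨hr, hrR⟩).1
    by_contra! hlt
    have h2 := pow_le_of_le_one (div_pos (S.g_pos r hr) hr).le (hlt.le.trans (min_le_left _ _)) hk
    linarith [hlt.trans_le (min_le_right _ _)]
  · have h1 : (S.g r / r) ^ k < 2 * θ := (hsub ⟨hr, hrR⟩).2
    by_contra! hlt
    have h2 := le_self_pow₀ ((le_max_left _ _).trans hlt.le) hk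
    linarith [(le_max_right _ _).trans_lt hlt]

theorem IsNonsingular.hasConeAngle {n : ℕ} {S : RadialSpace n} (h : S.IsNonsingular) :
    S.HasConeAngle 1 :=
  ⟨one_pos, by simpa using h.pow (n - 1)⟩

end RadialSpace

end RadialDomination

/-! ### Integrating the differential inequality -/

namespace RadialDomination

/-- A monotone function whose derivative is almost everywhere at least `m` on `[0, r]` increases
there by at least `m * r`. -/
theorem mul_le_sub_of_ae_le_deriv {f : ℝ → ℝ} (hf : Monotone f) {r m : ℝ} (hr : 0 ≤ r)
    (hm : ∀ᵐ s, s ∈ Set.Ioo 0 r → m ≤ deriv f s) : m * r ≤ f r - f 0 := by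
  have hmono : MonotoneOn f (Set.uIcc 0 r) := hf.monotoneOn _
  -- For a monotone function the integral of the derivative is at most the increment; absolute
  -- continuity is not needed in this direction.
  have h1 := hmono.intervalIntegral_deriv_mem_uIcc
  rw [Set.uIcc_of_le (sub_nonneg.2 (hf hr))] at h1
  refine le_trans ?_ h1.2
  calc m * r = ∫ _ in (0 : ℝ)..r, m := by simp [mul_comm]
    _ ≤ _ := by
      refine intervalIntegral.integral_mono_ae_restrict hr (by simp)
        hmono.intervalIntegrable_deriv ?_
      rw [← restrict_Ioo_eq_restrict_Icc]
      exact (ae_restrict_iff' measurableSet_Ioo).2 hm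

/-- Integration of an isoperimetric differential inequality: if `V' ≥ c T ^ k` almost everywhere
whenever `V ≤ (K T) ^ (k + 1)`, then `V` grows at least like a multiple of `r ^ (k + 1)`. -/
theorem pow_le_of_isoperimetric {V : ℝ → ℝ} (hV : Monotone V) (hV0 : V 0 = 0) {k : ℕ}
    {c K r : ℝ} (hc : 0 ≤ c) (hK : 0 < K) (hr : 0 < r) (hpos : ∀ s, 0 < s → 0 < V s)
    (h : ∀ s ∈ Set.Ioo 0 r, ∀ D, HasDerivAt V D s →
      ∃ T : ℝ, 0 ≤ T ∧ V s ≤ (K * T) ^ (k + 1) ∧ c * T ^ k ≤ D) :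
    (c / ((k + 1) * K ^ k) * r) ^ (k + 1) ≤ V r := by
  let p : ℝ := ((k + 1 : ℕ) : ℝ)⁻¹
  have hp : 0 < p := by positivity
  have hnn : ∀ s, 0 ≤ V (max s 0) := fun s => hV0.symm.le.trans (hV (le_max_right s 0))
  -- The root linearises `V' ≥ const * V ^ (k / (k + 1))`. Truncating at `0` keeps the base
  -- nonnegative, so `W` is monotone on the whole line.
  let W : ℝ → ℝ := fun s => V (max s 0) ^ p
  have hW : Monotone W := fun s t hst =>
    Real.rpow_le_rpow (hnn s) (hV (max_le_max hst le_rfl)) hp.le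
  have hWpow : ∀ s, W s ^ (k + 1) = V (max s 0) := fun s =>
    Real.rpow_inv_natCast_pow (hnn s) k.succ_ne_zero
  have hWnn : ∀ s, 0 ≤ W s := fun s => Real.rpow_nonneg (hnn s) _
  have hder : ∀ᵐ s, s ∈ Set.Ioo 0 r → c / ((k + 1) * K ^ k) ≤ deriv W s := by
    filter_upwards [hW.ae_differentiableAt] with s hs hsr
    have hVs : 0 < V s := hpos s hsr.1
    have hmax : max s 0 = s := max_eq_left hsr.1.le
    have hWs : 0 < W s := by
      have : W s = V s ^ p := by simp only [W, hmax]
      rw [this]; exact Real.rpow_pos_of_pos hVs _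
    -- `V` is differentiated as the power `W ^ (k + 1)`, so almost everywhere differentiability is
    -- needed for `W` only.
    have hD : HasDerivAt V (((k + 1 : ℕ) : ℝ) * W s ^ k * deriv W s) s := by
      refine (hs.hasDerivAt.fun_pow (k + 1)).congr_of_eventuallyEq ?_
      filter_upwards [lt_mem_nhds hsr.1] with t ht
      rw [hWpow, max_eq_left ht.le]
    obtain ⟨T, hT, hle, hcD⟩ := h s hsr _ hD
    have hWT : W s ≤ K * T := by
      refine le_of_pow_le_pow_left₀ k.succ_ne_zero (by positivity) ?_
      rwa [hWpow, hmax]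
    have h1 : c * W s ^ k ≤ (k + 1) * K ^ k * deriv W s * W s ^ k := by
      calc c * W s ^ k ≤ c * (K * T) ^ k := by gcongr
        _ = K ^ k * (c * T ^ k) := by ring
        _ ≤ K ^ k * (((k + 1 : ℕ) : ℝ) * W s ^ k * deriv W s) := by gcongr
        _ = _ := by push_cast; ring
    have h2 := le_of_mul_le_mul_right h1 (by positivity)
    rw [div_le_iff₀ (by positivity)]
    linarith
  have hW0 : W 0 = 0 := by simp [W, hV0, Real.zero_rpow hp.ne']
  have hfin := mul_le_sub_of_ae_le_deriv hW hr.le hder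
  rw [hW0, sub_zero] at hfin
  calc _ ≤ W r ^ (k + 1) := by gcongr
    _ = V r := by rw [hWpow, max_eq_left hr.le]

end RadialDomination

namespace RadialDomination

/-! ### Uniform lower bound for small balls -/

section Main

variable {X : Type*} [MetricSpace X] [ProperSpace X] [MeasurableSpace X] [BorelSpace X]

/-- In a space dominated by a radial space with a cone singularity, the volume of small balls is
bounded below by a multiple of `r ^ (k + 1)`, uniformly in the centre. -/
theorem exists_pow_le_measure_ball (μ : Measure X) [IsLocallyFiniteMeasure μ]
    [μ.IsOpenPosMeasure] [Nonempty X] {k : ℕ} (hk : k ≠ 0) (S : RadialSpace (k + 1)) {θ : ℝ}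
    (hS : S.HasConeAngle θ) (hdom : IsDominatedBy μ S) :
    ∃ m > 0, ∃ r₀ > 0, ∀ r : ℝ, 0 < r → r < r₀ → ∀ x : X,
      ENNReal.ofReal ((m * r) ^ (k + 1)) ≤ μ (Metric.ball x r) := by
  obtain ⟨a, b, R, ha0, ha1, hb1, hR, ha, hb⟩ := hS.exists_bounds hk
  obtain ⟨c, hc, K, hK, t₀, ht₀, hprof⟩ := S.exists_le_radialProfile hk ha ha0 ha1 hb hb1 hR
  -- Below `t₁` both the profile estimate and the domination inequality apply.
  obtain ⟨t₁, ht₁, ht₁₀, htμ⟩ : ∃ t₁ : ℝ, 0 < t₁ ∧ t₁ ≤ t₀ ∧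
      ENNReal.ofReal t₁ ≤ μ Set.univ / 2 := by
    have hpos : 0 < min (ENNReal.ofReal t₀) (μ Set.univ / 2) :=
      lt_min (ENNReal.ofReal_pos.2 ht₀) (ENNReal.half_pos
        (isOpen_univ.measure_pos μ Set.univ_nonempty).ne')
    have htop : min (ENNReal.ofReal t₀) (μ Set.univ / 2) ≠ ∞ :=
      ((min_le_left _ _).trans_lt ENNReal.ofReal_lt_top).ne
    refine ⟨(min (ENNReal.ofReal t₀) (μ Set.univ / 2)).toReal, ENNReal.toReal_pos hpos.ne' htop,
      ENNReal.toReal_le_of_le_ofReal ht₀.le (min_le_left _ _), ?_⟩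
    rw [ENNReal.ofReal_toReal htop]
    exact min_le_right _ _
  set m := c / ((k + 1) * K ^ k) with hm
  have hm0 : 0 < m := by positivity
  obtain ⟨r₀, hr₀, hr₀m⟩ : ∃ r₀ > 0, ∀ r : ℝ, 0 < r → r < r₀ → (m * r) ^ (k + 1) ≤ t₁ := by
    have hlim : Tendsto (fun r : ℝ => (m * r) ^ (k + 1)) (𝓝[>] 0) (𝓝 0) := by
      have : Continuous fun r : ℝ => (m * r) ^ (k + 1) := by fun_prop
      simpa using (this.tendsto 0).mono_left (nhdsWithin_le_nhds (s := Set.Ioi 0))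
    obtain ⟨r₀, hr₀, hsub⟩ :=
      mem_nhdsGT_iff_exists_Ioo_subset.1 (hlim.eventually (gt_mem_nhds ht₁))
    exact ⟨r₀, hr₀, fun r h0 h1 => (hsub ⟨h0, h1⟩ : _ < t₁).le⟩
  refine ⟨m, hm0, r₀, hr₀, fun r hr hrr x => ?_⟩
  let V : ℝ → ℝ := fun s => μ.real (Metric.ball x s)
  have hV : Monotone V := fun s t hst =>
    measureReal_mono (Metric.ball_subset_ball hst) measure_ball_lt_top.ne
  have hμV : ∀ s, μ (Metric.ball x s) = ENNReal.ofReal (V s) := fun s =>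
    (ENNReal.ofReal_toReal measure_ball_lt_top.ne).symm
  rw [hμV]
  refine ENNReal.ofReal_le_ofReal ?_
  rcases le_total t₁ (V r) with hlarge | hsmall
  · exact (hr₀m r hr hrr).trans hlarge
  refine pow_le_of_isoperimetric hV (by simp [V]) hc.le hK hr (fun s hs =>
    ENNReal.toReal_pos (Metric.measure_ball_pos μ x hs).ne' measure_ball_lt_top.ne) ?_
  intro s hs D hD
  have hVs : V s ≤ t₁ := (hV hs.2.le).trans hsmall
  obtain ⟨T, hT, hle, hcT⟩ := hprof (V s) measureReal_nonneg (hVs.trans ht₁₀)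
  refine ⟨T, hT, hle, ?_⟩
  have hchain : ENNReal.ofReal (c * T ^ k) ≤ ENNReal.ofReal D :=
    calc _ ≤ S.radialProfile (ENNReal.ofReal (V s)) := hcT
      _ ≤ isoperimetricProfile μ (ENNReal.ofReal (V s)) :=
        hdom.2 _ ((ENNReal.ofReal_le_ofReal hVs).trans htμ)
      _ ≤ perimeter μ (Metric.ball x s) :=
        iInf₂_le_of_le (Metric.ball x s) measurableSet_ball
          (iInf₂_le_of_le (hμV s) Metric.isBounded_ball.isCompact_closure le_rfl)
      _ ≤ ENNReal.ofReal D := perimeter_ball_le μ hD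
  -- `ENNReal.ofReal` truncates at `0`, so the sign of `D` is needed to return to real numbers.
  have hD0 : 0 ≤ D := by
    rw [← hD.deriv]
    exact hV.deriv_nonneg
  exact (ENNReal.ofReal_le_ofReal_iff hD0).1 hchain

end Main

end RadialDomination

theorem mainTheorem6 {X : Type*} [MetricSpace X] [ProperSpace X] [MeasurableSpace X] [BorelSpace X]
    (μ : Measure X) [IsLocallyFiniteMeasure μ] [μ.IsOpenPosMeasure]
    (n : ℕ) (hn : 2 ≤ n) (S : RadialDomination.RadialSpace n)
    (hS : S.IsNonsingular ∨ ∃ θ : ℝ, S.HasConeAngle θ)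
    (hdom : RadialDomination.IsDominatedBy μ S) :
    (∀ r : ℝ, 0 < r → 0 < ⨅ x : X, μ (Metric.ball x r)) ∧
      0 < liminf (fun r : ℝ => ⨅ x : X, μ (Metric.ball x r) /
        (RadialDomination.unitBallVolume n * ENNReal.ofReal r ^ n)) (𝓝[>] (0 : ℝ)) := by
  obtain ⟨k, rfl⟩ : ∃ k, n = k + 1 := ⟨n - 1, by omega⟩
  have hcone : ∃ θ : ℝ, S.HasConeAngle θ :=
    hS.elim (fun h => ⟨1, h.hasConeAngle⟩) id
  obtain ⟨θ, hθ⟩ := hcone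
  -- Over an empty space the infima are `∞`.
  rcases isEmpty_or_nonempty X with hX | hX
  · simp only [iInf_of_empty]
    exact ⟨fun _ _ => ENNReal.zero_lt_top, by simp⟩
  obtain ⟨m, hm, r₀, hr₀, hball⟩ :=
    RadialDomination.exists_pow_le_measure_ball μ (by omega) S hθ hdom
  refine ⟨fun r hr => ?_, ?_⟩
  -- Large balls contain concentric balls of radius below `r₀`.
  · have hρ : 0 < min r (r₀ / 2) := by positivity
    refine lt_of_lt_of_le (ENNReal.ofReal_pos.2 (by positivity :
      0 < (m * min r (r₀ / 2)) ^ (k + 1))) (le_iInf fun x => ?_)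
    exact (hball _ hρ ((min_le_right _ _).trans_lt (by linarith)) x).trans
      (measure_mono (Metric.ball_subset_ball (min_le_left _ _)))
  · have hω := RadialDomination.unitBallVolume_ne_top (k := k + 1)
    refine lt_of_lt_of_le (ENNReal.div_pos (ENNReal.ofReal_pos.2 (by positivity :
      0 < m ^ (k + 1))).ne' hω) (le_liminf_of_le (by isBoundedDefault) ?_)
    filter_upwards [Ioo_mem_nhdsGT hr₀] with r hr
    refine le_iInf fun x => ?_
    have hr0 : ENNReal.ofReal r ^ (k + 1) ≠ 0 := pow_ne_zero _ (ENNReal.ofReal_pos.2 hr.1).ne'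
    have hrt : ENNReal.ofReal r ^ (k + 1) ≠ ∞ := ENNReal.pow_ne_top ENNReal.ofReal_ne_top
    rw [← ENNReal.mul_div_mul_right _ _ hr0 hrt, ← ENNReal.ofReal_pow hr.1.le,
      ← ENNReal.ofReal_mul (by positivity), ← mul_pow]
    gcongr
    exact hball r hr.1 hr.2 x
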